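/- Let $C$ be a (coassociative, counital) coalgebra over a field $k$, with comultiplication $\Delta(c)=c_1\otimes c_2$ (Sweedler notation, implicit summation) and counit $\epsilon$. The dual space $C^*=\mathrm{Hom}_k(C,k)$ is an associative unital algebra under convolution, $(\varphi*\psi)(c)=\varphi(c_1)\psi(c_2)$, and $C$ is a left and a right $C^*$-module via $\varphi\cdot c=c_1\varphi(c_2)$ and $c\cdot\varphi=\varphi(c_1)c_2$. The coalgebra $C$ is called left (respectively right) co-Frobenius if there is a monomorphism $C\to C^*$ of left (respectively right) $C^*$-modules. We say that the coalgebra structure of $C$ extends to a non-unital Frobenius algebra by means of a $k$-linear map $\mu:C\otimes C\to C$, $\mu(r\otimes s)=rs$, if $\mu$ is associative (a unit is not required) and $$(\mu\otimes C)\circ(C\otimes\Delta)=\Delta\circ\mu=(C\otimes\mu)\circ(\Delta\otimes C).$$ The multiplication is non-degenerate if each of the conditions ($sr=0$ for all $s\in C$) and ($rs=0$ for all $s\in C$) implies $r=0$. The Frobenius algebra is firm if $\mu$ projects to a bijection $C\otimes_C C\to C$, where $C\otimes_C C$ denotes the coequalizer of $\mu\otimes C$ and $C\otimes\mu$. It has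 local units if there is a set $\mathsf E\subseteq C$ of idempotents such that for every finite set $r_1,\dots,r_n\in C$ there is $e\in\mathsf E$ with $er_i=r_i=r_ie$ for all $i$. The following assertions are equivalent. 1. $C$ is a left and right co-Frobenius coalgebra. 2. The given coalgebra structure of $C$ extends to a non-unital Frobenius algebra with a non-degenerate multiplication. 3. The given coalgebra structure of $C$ extends to a firm Frobenius algebra whose multiplication admits local units. -/

import Mathlib

open scoped TensorProduct

noncomputable section

namespace CoFrob

universe u v

variable (k : Type u) (C : Type v) [Field k] [AddCommGroup C] [Module k C] [Coalgebra k C]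

/-! ### The dual algebra `C*` of a coalgebra `C`, and `C` as a `C*`-bimodule -/

/-- The dual vector space `C*` of a coalgebra, regarded as an associative unital algebra via the
convolution product `(φ * ψ) c = φ c₁ * ψ c₂`, whose unit is the counit. -/
abbrev ConvDual : Type (max u v) := WithConv (C →ₗ[k] k)

variable {k C}

/-- The left action `φ ⇀ c = c₁ φ(c₂)`. -/
def leftAct (φ : ConvDual k C) : C →ₗ[k] C :=
  (TensorProduct.rid k C).toLinearMap ∘ₗ LinearMap.lTensor C φ.ofConv ∘ₗ
    Coalgebra.comul (R := k) (A := C)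

/-- The right action `c ↼ φ = φ(c₁) c₂`. -/
def rightAct (φ : ConvDual k C) : C →ₗ[k] C :=
  (TensorProduct.lid k C).toLinearMap ∘ₗ LinearMap.rTensor C φ.ofConv ∘ₗ
    Coalgebra.comul (R := k) (A := C)

theorem leftAct_one (c : C) : leftAct (1 : ConvDual k C) c = c := by
  have h : (1 : ConvDual k C).ofConv = Coalgebra.counit := by
    ext x; exact LinearMap.convOne_apply x
  simp [leftAct, h]

theorem rightAct_one (c : C) : rightAct (1 : ConvDual k C) c = c := by
  have h : (1 : ConvDual k C).ofConv = Coalgebra.counit := by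
    ext x; exact LinearMap.convOne_apply x
  simp [rightAct, h]

theorem leftAct_mul (φ ψ : ConvDual k C) (c : C) :
    leftAct (φ * ψ) c = leftAct φ (leftAct ψ c) := by
  let T : C ⊗[k] (C ⊗[k] C) →ₗ[k] C :=
    (TensorProduct.rid k C).toLinearMap ∘ₗ LinearMap.lTensor C
      (LinearMap.mul' k k ∘ₗ TensorProduct.map φ.ofConv ψ.ofConv)
  have h1 : leftAct (φ * ψ) c = T (LinearMap.lTensor C Coalgebra.comul
      (Coalgebra.comul (R := k) c)) := by
    simp only [leftAct, T, LinearMap.comp_apply, LinearMap.convMul_def]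
    rw [← LinearMap.lTensor_comp_apply]
    rfl
  have h2 : ∀ t : C ⊗[k] C, T (TensorProduct.assoc k C C C
      (LinearMap.rTensor C Coalgebra.comul t)) =
      leftAct φ (TensorProduct.rid k C (LinearMap.lTensor C ψ.ofConv t)) := by
    intro t
    induction t with
    | zero => simp
    | add x y hx hy => simp only [map_add, hx, hy]
    | tmul a b =>
      simp only [LinearMap.rTensor_tmul, LinearMap.lTensor_tmul, TensorProduct.rid_tmul, map_smul,
        leftAct, LinearMap.comp_apply]
      induction Coalgebra.comul (R := k) a with
      | zero => simp
      | add x y hx hy => simp only [map_add, TensorProduct.add_tmul, hx, hy, smul_add]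
      | tmul x y => simp [T, smul_smul, mul_comm]
  rw [h1, ← Coalgebra.coassoc_apply, h2]
  rfl

theorem rightAct_mul (φ ψ : ConvDual k C) (c : C) :
    rightAct (φ * ψ) c = rightAct ψ (rightAct φ c) := by
  let T : (C ⊗[k] C) ⊗[k] C →ₗ[k] C :=
    (TensorProduct.lid k C).toLinearMap ∘ₗ LinearMap.rTensor C
      (LinearMap.mul' k k ∘ₗ TensorProduct.map φ.ofConv ψ.ofConv)
  have h1 : rightAct (φ * ψ) c = T (LinearMap.rTensor C Coalgebra.comul
      (Coalgebra.comul (R := k) c)) := by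
    simp only [rightAct, T, LinearMap.comp_apply, LinearMap.convMul_def]
    rw [← LinearMap.rTensor_comp_apply]
    rfl
  have h2 : ∀ t : C ⊗[k] C, T ((TensorProduct.assoc k C C C).symm
      (LinearMap.lTensor C Coalgebra.comul t)) =
      rightAct ψ (TensorProduct.lid k C (LinearMap.rTensor C φ.ofConv t)) := by
    intro t
    induction t with
    | zero => simp
    | add x y hx hy => simp only [map_add, hx, hy]
    | tmul a b =>
      simp only [LinearMap.rTensor_tmul, LinearMap.lTensor_tmul, TensorProduct.lid_tmul, map_smul,
        rightAct, LinearMap.comp_apply]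
      induction Coalgebra.comul (R := k) b with
      | zero => simp
      | add x y hx hy => simp only [map_add, TensorProduct.tmul_add, hx, hy, smul_add]
      | tmul x y => simp [T, mul_smul]
  rw [h1, ← Coalgebra.coassoc_symm_apply, h2]
  rfl

variable (k C)

/-- `C` as a left `C*`-module via `φ • c = c₁ φ(c₂)`. -/
abbrev leftModule : Module (ConvDual k C) C where
  smul φ c := leftAct φ c
  one_smul := leftAct_one
  mul_smul := leftAct_mul
  smul_zero φ := map_zero (leftAct φ)
  smul_add φ := map_add (leftAct φ)
  add_smul φ ψ c := by
    change leftAct (φ + ψ) c = leftAct φ c + leftAct ψ c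
    simp [leftAct, LinearMap.lTensor_add]
  zero_smul c := by
    change leftAct (0 : ConvDual k C) c = 0
    simp [leftAct]

/-- `C` as a right `C*`-module via `c • φ = φ(c₁) c₂`; a right module is a left module over the
opposite ring. -/
abbrev rightModule : Module (ConvDual k C)ᵐᵒᵖ C where
  smul φ c := rightAct φ.unop c
  one_smul := rightAct_one
  mul_smul φ ψ c := rightAct_mul ψ.unop φ.unop c
  smul_zero φ := map_zero (rightAct φ.unop)
  smul_add φ := map_add (rightAct φ.unop)
  add_smul φ ψ c := by
    change rightAct (φ.unop + ψ.unop) c = rightAct φ.unop c + rightAct ψ.unop c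
    simp [rightAct, LinearMap.rTensor_add]
  zero_smul c := by
    change rightAct (0 : ConvDual k C) c = 0
    simp [rightAct]

/-- `C` is left co-Frobenius: there is a monomorphism `C → C*` of left `C*`-modules, where `C*`
is the left regular module. -/
def IsLeftCoFrobenius : Prop :=
  letI := leftModule k C
  ∃ f : C →ₗ[ConvDual k C] ConvDual k C, Function.Injective f

/-- `C` is right co-Frobenius: there is a monomorphism `C → C*` of right `C*`-modules, where `C*`
is the right regular module. -/
def IsRightCoFrobenius : Prop :=
  letI := rightModule k C
  ∃ f : C →ₗ[(ConvDual k C)ᵐᵒᵖ] ConvDual k C, Function.Injective f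

/-! ### Non-unital Frobenius algebras -/

/-- An extension of the given coalgebra structure on `C` to a (not necessarily unital) Frobenius
algebra: an associative `k`-linear multiplication `μ : C ⊗ C → C` such that
`(μ ⊗ C) ∘ (C ⊗ Δ) = Δ ∘ μ = (C ⊗ μ) ∘ (Δ ⊗ C)`. -/
structure NonUnitalFrobenius where
  /-- the multiplication -/
  mul : C ⊗[k] C →ₗ[k] C
  mul_assoc : mul ∘ₗ LinearMap.rTensor C mul =
    mul ∘ₗ LinearMap.lTensor C mul ∘ₗ (TensorProduct.assoc k C C C).toLinearMap
  comul_left : LinearMap.rTensor C mul ∘ₗ (TensorProduct.assoc k C C C).symm.toLinearMap ∘ₗ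
    LinearMap.lTensor C (Coalgebra.comul (R := k)) = Coalgebra.comul ∘ₗ mul
  comul_right : LinearMap.lTensor C mul ∘ₗ (TensorProduct.assoc k C C C).toLinearMap ∘ₗ
    LinearMap.rTensor C (Coalgebra.comul (R := k)) = Coalgebra.comul ∘ₗ mul

namespace NonUnitalFrobenius

variable {k C} (R : NonUnitalFrobenius k C)

/-- Non-degeneracy of the multiplication: `(∀ s, s r = 0) → r = 0` and
`(∀ s, r s = 0) → r = 0`. -/
def NonDegenerate : Prop :=
  (∀ r : C, (∀ s : C, R.mul (s ⊗ₜ r) = 0) → r = 0) ∧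
  (∀ r : C, (∀ s : C, R.mul (r ⊗ₜ s) = 0) → r = 0)

/-- The submodule of `C ⊗ C` spanned by the elements `rs ⊗ t - r ⊗ st`. -/
def balancing : Submodule k (C ⊗[k] C) :=
  LinearMap.range (LinearMap.rTensor C R.mul -
    LinearMap.lTensor C R.mul ∘ₗ (TensorProduct.assoc k C C C).toLinearMap)

theorem balancing_le_ker : R.balancing ≤ LinearMap.ker R.mul := by
  rintro _ ⟨t, rfl⟩
  have h := LinearMap.congr_fun R.mul_assoc t
  simp only [LinearMap.comp_apply] at h
  simp [h]

/-- The map `R ⊗_R R → R` induced by the multiplication, where `R ⊗_R R` is the coequalizer of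
`μ ⊗ R` and `R ⊗ μ`, i.e. the quotient of `R ⊗ R` by `balancing`. -/
def mulBalanced : (C ⊗[k] C) ⧸ R.balancing →ₗ[k] C :=
  R.balancing.liftQ R.mul R.balancing_le_ker

/-- The algebra is firm: the multiplication projects to an isomorphism `R ⊗_R R → R`. -/
def Firm : Prop := Function.Bijective R.mulBalanced

/-- The algebra has local units: there is a set `E` of idempotents such that every finite set of
elements admits a common two-sided unit in `E`. -/
def HasLocalUnits : Prop :=
  ∃ E : Set C, (∀ e ∈ E, R.mul (e ⊗ₜ e) = e) ∧
    ∀ F : Finset C, ∃ e ∈ E, ∀ r ∈ F, R.mul (e ⊗ₜ r) = r ∧ R.mul (r ⊗ₜ e) = r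

end NonUnitalFrobenius

end CoFrob

end

noncomputable section

namespace CoFrob

open WithConv

universe u v

variable {k : Type u} {C : Type v} [Field k] [AddCommGroup C] [Module k C] [Coalgebra k C]

/-! ### The two actions of the dual algebra -/

/-! Everything is translated into bilinear forms `B` with `r₁ B(s, r₂) = B(s₁, r) s₂`. A left
(right) `C*`-linear map `C → C*` amounts to such a balanced form, and its injectivity to triviality
of the left (right) radical. A balanced form gives the Frobenius product `r s = r₁ B(s, r₂)`;
conversely `B(s, r) = ε(r s)` recovers the form.

The two co-Frobenius conditions supply two unrelated forms, each with one trivial radical.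
`flip_injective` shows that a single form already has both radicals trivial, because every `C* ⇀ x`
is finite dimensional.

For local units, a form with trivial radical interpolates `ε` on finite sets, which yields one-sided
units. Multiplication by a fixed element has finite rank, so a Fitting argument makes these units
idempotent; a left and a right one then combine into a two-sided one. Local units imply firmness and
non-degeneracy directly. -/

theorem leftAct_apply_repr {c : C} {ι : Type*} (𝓡 : Coalgebra.Repr k c ι) (φ : ConvDual k C) :
    leftAct φ c = ∑ i ∈ 𝓡.index, φ.ofConv (𝓡.right i) • 𝓡.left i := by
  simp [leftAct, ← 𝓡.eq]

theorem rightAct_apply_repr {c : C} {ι : Type*} (𝓡 : Coalgebra.Repr k c ι) (φ : ConvDual k C) :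
    rightAct φ c = ∑ i ∈ 𝓡.index, φ.ofConv (𝓡.left i) • 𝓡.right i := by
  simp [rightAct, ← 𝓡.eq]

theorem ofConv_one_apply (c : C) :
    (1 : ConvDual k C).ofConv c = Coalgebra.counit (R := k) c :=
  LinearMap.convOne_apply c

theorem ofConv_mul_apply_leftAct (φ ψ : ConvDual k C) (c : C) :
    (φ * ψ).ofConv c = φ.ofConv (leftAct ψ c) := by
  rw [(Coalgebra.Repr.arbitrary k c).convMul_apply,
    leftAct_apply_repr (Coalgebra.Repr.arbitrary k c)]
  simp [mul_comm]

theorem ofConv_mul_apply_rightAct (φ ψ : ConvDual k C) (c : C) :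
    (φ * ψ).ofConv c = ψ.ofConv (rightAct φ c) := by
  rw [(Coalgebra.Repr.arbitrary k c).convMul_apply,
    rightAct_apply_repr (Coalgebra.Repr.arbitrary k c)]
  simp

theorem counit_leftAct (φ : ConvDual k C) (c : C) :
    Coalgebra.counit (R := k) (leftAct φ c) = φ.ofConv c := by
  have h := ofConv_mul_apply_leftAct (1 : ConvDual k C) φ c
  rw [one_mul] at h
  rw [h]
  exact (ofConv_one_apply (leftAct φ c)).symm

/-- The left action of the dual algebra, as a linear map in the functional. -/
def leftActHom : (C →ₗ[k] k) →ₗ[k] C →ₗ[k] C where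
  toFun φ := leftAct (toConv φ)
  map_add' φ ψ := by
    ext c
    simp [leftAct_apply_repr (Coalgebra.Repr.arbitrary k c), add_smul, Finset.sum_add_distrib]
  map_smul' a φ := by
    ext c
    simp [leftAct_apply_repr (Coalgebra.Repr.arbitrary k c), mul_smul, Finset.smul_sum]

theorem comul_leftAct (φ : ConvDual k C) (c : C) :
    Coalgebra.comul (R := k) (leftAct φ c) =
      LinearMap.lTensor C (leftAct φ) (Coalgebra.comul (R := k) c) := by
  let T : C ⊗[k] C ⊗[k] C →ₗ[k] C ⊗[k] C :=
    (TensorProduct.rid k _).toLinearMap ∘ₗ LinearMap.lTensor _ φ.ofConv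
  have h1 : ∀ t : C ⊗[k] C, T (LinearMap.rTensor C Coalgebra.comul t) =
      Coalgebra.comul (R := k) (TensorProduct.rid k C (LinearMap.lTensor C φ.ofConv t)) := by
    intro t
    induction t with
    | zero => simp
    | add x y hx hy => simp only [map_add, hx, hy]
    | tmul a b => simp [T]
  have h2 : ∀ t : C ⊗[k] C, T ((TensorProduct.assoc k C C C).symm
      (LinearMap.lTensor C Coalgebra.comul t)) = LinearMap.lTensor C (leftAct φ) t := by
    intro t
    induction t with
    | zero => simp
    | add x y hx hy => simp only [map_add, hx, hy]
    | tmul a b =>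
      simp only [LinearMap.lTensor_tmul, leftAct, LinearMap.comp_apply]
      induction Coalgebra.comul (R := k) b with
      | zero => simp
      | add x y hx hy => simp only [map_add, TensorProduct.tmul_add, hx, hy]
      | tmul x y => simp [T]
  rw [← h2, Coalgebra.coassoc_symm_apply, h1]
  rfl

theorem comul_rightAct (φ : ConvDual k C) (c : C) :
    Coalgebra.comul (R := k) (rightAct φ c) =
      LinearMap.rTensor C (rightAct φ) (Coalgebra.comul (R := k) c) := by
  let T : C ⊗[k] (C ⊗[k] C) →ₗ[k] C ⊗[k] C :=
    (TensorProduct.lid k _).toLinearMap ∘ₗ LinearMap.rTensor _ φ.ofConv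
  have h1 : ∀ t : C ⊗[k] C, T (LinearMap.lTensor C Coalgebra.comul t) =
      Coalgebra.comul (R := k) (TensorProduct.lid k C (LinearMap.rTensor C φ.ofConv t)) := by
    intro t
    induction t with
    | zero => simp
    | add x y hx hy => simp only [map_add, hx, hy]
    | tmul a b => simp [T]
  have h2 : ∀ t : C ⊗[k] C, T (TensorProduct.assoc k C C C
      (LinearMap.rTensor C Coalgebra.comul t)) = LinearMap.rTensor C (rightAct φ) t := by
    intro t
    induction t with
    | zero => simp
    | add x y hx hy => simp only [map_add, hx, hy]
    | tmul a b =>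
      simp only [LinearMap.rTensor_tmul, rightAct, LinearMap.comp_apply]
      induction Coalgebra.comul (R := k) a with
      | zero => simp
      | add x y hx hy => simp only [map_add, TensorProduct.add_tmul, hx, hy]
      | tmul x y => simp [T, TensorProduct.smul_tmul']
  rw [← h2, Coalgebra.coassoc_apply, h1]
  rfl

theorem leftAct_rightAct (φ ψ : ConvDual k C) (c : C) :
    leftAct φ (rightAct ψ c) = rightAct ψ (leftAct φ c) := by
  have h : ∀ t : C ⊗[k] C, TensorProduct.rid k C (LinearMap.lTensor C φ.ofConv
      (LinearMap.rTensor C (rightAct ψ) t)) =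
        rightAct ψ (TensorProduct.rid k C (LinearMap.lTensor C φ.ofConv t)) := by
    intro t
    induction t with
    | zero => simp
    | add x y hx hy => simp only [map_add, hx, hy]
    | tmul a b => simp
  rw [leftAct, LinearMap.comp_apply, LinearMap.comp_apply, comul_rightAct]
  exact h _

/-- The action on `c` only sees the values of `φ` on the finitely many tensor legs of `Δ(c)`, and
`ε` acts as the identity. -/
theorem exists_finset_leftAct_eq_self (c : C) : ∃ S : Finset C, ∀ φ : ConvDual k C,
    (∀ y ∈ S, φ.ofConv y = Coalgebra.counit (R := k) y) → leftAct φ c = c := by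
  classical
  let 𝓡 := Coalgebra.Repr.arbitrary k c
  refine ⟨𝓡.index.image 𝓡.right, fun φ h => ?_⟩
  conv_rhs => rw [← leftAct_one (k := k) c]
  rw [leftAct_apply_repr 𝓡, leftAct_apply_repr 𝓡]
  refine Finset.sum_congr rfl fun i hi => ?_
  rw [h _ (Finset.mem_image_of_mem _ hi), ofConv_one_apply]

theorem exists_finset_rightAct_eq_self (c : C) : ∃ S : Finset C, ∀ φ : ConvDual k C,
    (∀ y ∈ S, φ.ofConv y = Coalgebra.counit (R := k) y) → rightAct φ c = c := by
  classical
  let 𝓡 := Coalgebra.Repr.arbitrary k c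
  refine ⟨𝓡.index.image 𝓡.left, fun φ h => ?_⟩
  conv_rhs => rw [← rightAct_one (k := k) c]
  rw [rightAct_apply_repr 𝓡, rightAct_apply_repr 𝓡]
  refine Finset.sum_congr rfl fun i hi => ?_
  rw [h _ (Finset.mem_image_of_mem _ hi), ofConv_one_apply]

theorem exists_finiteDimensional_forall_leftAct_mem (c : C) : ∃ W : Submodule k C,
    FiniteDimensional k W ∧ ∀ φ : ConvDual k C, leftAct φ c ∈ W := by
  classical
  let 𝓡 := Coalgebra.Repr.arbitrary k c
  refine ⟨Submodule.span k (𝓡.index.image 𝓡.left : Finset C), inferInstance, fun φ => ?_⟩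
  rw [leftAct_apply_repr 𝓡]
  exact Submodule.sum_mem _ fun i hi => Submodule.smul_mem _ _
    (Submodule.subset_span (Finset.mem_coe.2 (Finset.mem_image_of_mem _ hi)))

theorem exists_finiteDimensional_forall_rightAct_mem (c : C) : ∃ W : Submodule k C,
    FiniteDimensional k W ∧ ∀ φ : ConvDual k C, rightAct φ c ∈ W := by
  classical
  let 𝓡 := Coalgebra.Repr.arbitrary k c
  refine ⟨Submodule.span k (𝓡.index.image 𝓡.right : Finset C), inferInstance, fun φ => ?_⟩
  rw [rightAct_apply_repr 𝓡]
  exact Submodule.sum_mem _ fun i hi => Submodule.smul_mem _ _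
    (Submodule.subset_span (Finset.mem_coe.2 (Finset.mem_image_of_mem _ hi)))

/-- If the functionals `B · d` separate the points of `C`, then they interpolate every functional
on finite sets. -/
theorem exists_forall_mem_eq_of_injective {V W : Type*} [AddCommGroup V] [Module k V]
    [AddCommGroup W] [Module k W] {B : V →ₗ[k] W →ₗ[k] k} (hB : Function.Injective B)
    (φ : V →ₗ[k] k) (S : Finset V) : ∃ d, ∀ y ∈ S, B y d = φ y := by
  let U : Submodule k V := Submodule.span k (S : Set V)
  have hU : Function.Injective (B ∘ₗ U.subtype) := hB.comp U.injective_subtype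
  -- As `U` is finite dimensional, injectivity of `U → W*` is equivalent to surjectivity of `W →
  -- U*`.
  obtain ⟨d, hd⟩ := (LinearMap.flip_surjective_iff₁ (B := B ∘ₗ U.subtype)).2 hU (φ ∘ₗ U.subtype)
  exact ⟨d, fun y hy => LinearMap.congr_fun hd ⟨y, Submodule.subset_span hy⟩⟩

theorem exists_rightAct_flip_eq_self {B : C →ₗ[k] C →ₗ[k] k} (hB : Function.Injective B)
    (F : Finset C) : ∃ d, ∀ r ∈ F, rightAct (toConv (B.flip d)) r = r := by
  classical
  choose S hS using exists_finset_rightAct_eq_self (k := k) (C := C)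
  obtain ⟨d, hd⟩ := exists_forall_mem_eq_of_injective hB Coalgebra.counit (F.biUnion S)
  exact ⟨d, fun r hr => hS r _ fun y hy => hd y (Finset.mem_biUnion.2 ⟨r, hr, hy⟩)⟩

theorem exists_leftAct_eq_self {B : C →ₗ[k] C →ₗ[k] k} (hB : Function.Injective B.flip)
    (F : Finset C) : ∃ d, ∀ r ∈ F, leftAct (toConv (B d)) r = r := by
  classical
  choose S hS using exists_finset_leftAct_eq_self (k := k) (C := C)
  obtain ⟨d, hd⟩ := exists_forall_mem_eq_of_injective hB Coalgebra.counit (F.biUnion S)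
  exact ⟨d, fun r hr => hS r _ fun y hy => hd y (Finset.mem_biUnion.2 ⟨r, hr, hy⟩)⟩

/-! ### Balanced bilinear forms -/

/-- A bilinear form `B` is balanced if `r₁ B(s, r₂) = B(s₁, r) s₂`. -/
def IsBalanced (B : C →ₗ[k] C →ₗ[k] k) : Prop :=
  ∀ r s, leftAct (toConv (B s)) r = rightAct (toConv (B.flip r)) s

namespace IsBalanced

/-- Any functional `φ` takes the value `B(φ ⇀ s, r)` on both sides of the balancing identity, and
functionals separate points. -/
theorem of_left {B : C →ₗ[k] C →ₗ[k] k}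
    (h : ∀ φ s, toConv (B (leftAct φ s)) = φ * toConv (B s)) : IsBalanced B := by
  intro r s
  rw [← sub_eq_zero, ← Module.forall_dual_apply_eq_zero_iff k]
  intro φ
  have h1 := ofConv_mul_apply_leftAct (toConv φ) (toConv (B s)) r
  have h2 := ofConv_mul_apply_rightAct (toConv (B.flip r)) (toConv φ) s
  rw [ofConv_mul_apply_leftAct] at h2
  rw [← h] at h1
  rw [map_sub, sub_eq_zero]
  exact h1.symm.trans h2

theorem of_right {B : C →ₗ[k] C →ₗ[k] k}
    (h : ∀ φ r, toConv (B.flip (rightAct φ r)) = toConv (B.flip r) * φ) : IsBalanced B := by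
  intro r s
  rw [← sub_eq_zero, ← Module.forall_dual_apply_eq_zero_iff k]
  intro φ
  have h1 := ofConv_mul_apply_rightAct (toConv (B.flip r)) (toConv φ) s
  have h2 := ofConv_mul_apply_leftAct (toConv φ) (toConv (B s)) r
  rw [ofConv_mul_apply_rightAct] at h2
  rw [← h] at h1
  rw [map_sub, sub_eq_zero]
  exact h2.symm.trans h1

variable {B B' : C →ₗ[k] C →ₗ[k] k}

theorem toConv_leftAct (hB : IsBalanced B) (φ : ConvDual k C) (s : C) :
    toConv (B (leftAct φ s)) = φ * toConv (B s) := by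
  ext r
  rw [ofConv_mul_apply_leftAct, hB r s, ← ofConv_mul_apply_rightAct, ofConv_mul_apply_leftAct]
  rfl

theorem toConv_flip_rightAct (hB : IsBalanced B) (φ : ConvDual k C) (r : C) :
    toConv (B.flip (rightAct φ r)) = toConv (B.flip r) * φ := by
  ext s
  rw [ofConv_mul_apply_rightAct, ← hB r s, ← ofConv_mul_apply_leftAct, ofConv_mul_apply_rightAct]
  rfl

theorem isLeftCoFrobenius (hB : IsBalanced B) (hi : Function.Injective B) :
    IsLeftCoFrobenius k C := by
  let _ := leftModule k C
  exact ⟨{ toFun := fun s => toConv (B s)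
           map_add' := fun x y => by simp
           map_smul' := fun φ s => hB.toConv_leftAct φ s }, toConv_injective.comp hi⟩

theorem isRightCoFrobenius (hB : IsBalanced B) (hi : Function.Injective B.flip) :
    IsRightCoFrobenius k C := by
  let _ := rightModule k C
  exact ⟨{ toFun := fun s => toConv (B.flip s)
           map_add' := fun x y => by simp
           map_smul' := fun φ s => hB.toConv_flip_rightAct φ.unop s }, toConv_injective.comp hi⟩

/-- Given two balanced forms, if the first one has trivial left radical and the second one has
trivial right radical, then the right radical of the first one is trivial, too. -/
theorem flip_injective (hB : IsBalanced B) (hB' : IsBalanced B') (hi : Function.Injective B)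
    (hi' : Function.Injective B'.flip) : Function.Injective B.flip := by
  rw [injective_iff_map_eq_zero]
  intro x hx
  -- `M = C* ⇀ x`. The aim is an element `w = B(c)` of `C*` that annihilates `x` yet acts
  -- bijectively on `M`.
  set M : Submodule k C := LinearMap.range ((leftActHom (k := k) (C := C)).flip x) with hM
  have : FiniteDimensional k M := by
    obtain ⟨W, _, hW⟩ := exists_finiteDimensional_forall_leftAct_mem (k := k) x
    refine Submodule.finiteDimensional_of_le (S₂ := W) ?_
    rintro _ ⟨φ, rfl⟩
    exact hW (toConv φ)
  have hstab : ∀ (φ : ConvDual k C), ∀ y ∈ M, leftAct φ y ∈ M := by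
    rintro φ _ ⟨ψ, rfl⟩
    exact ⟨(φ * toConv ψ).ofConv, leftAct_mul φ (toConv ψ) x⟩
  have hxM : x ∈ M := ⟨(1 : ConvDual k C).ofConv, leftAct_one x⟩
  obtain ⟨T, hT⟩ : M.FG := (Submodule.fg_top M).1 Module.Finite.fg_top
  obtain ⟨c, hc⟩ := exists_leftAct_eq_self hi' T
  have hcM : ∀ y ∈ M, leftAct (toConv (B' c)) y = y := by
    intro y hy
    rw [← hT] at hy
    exact LinearMap.eqOn_span (f := leftAct (toConv (B' c))) (g := LinearMap.id) hc hy
  obtain ⟨d, hd⟩ := exists_rightAct_flip_eq_self hi {c}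
  replace hd := hd c (Finset.mem_singleton_self c)
  set w : ConvDual k C := toConv (B c)
  set v : ConvDual k C := toConv (B' (rightAct (toConv (B'.flip c)) d))
  -- By balancedness `hd` reads `w ⇀ d = c`. Since the two actions commute, `w * v = B'(c ↼ B'(-,
  -- c)) = B'(B'(c) ⇀ c) = B'(c) * B'(c)`, which is the identity on `M`.
  have hwv : w * v = toConv (B' c) * toConv (B' c) := by
    rw [← hB'.toConv_leftAct, ← hB'.toConv_leftAct, leftAct_rightAct, hB, hd, hB']
  let fw : M →ₗ[k] M := (leftAct w).restrict (hstab w)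
  have hfw : Function.Surjective fw := fun y =>
    ⟨⟨leftAct v y, hstab v y y.2⟩, Subtype.ext <| by
      change leftAct w (leftAct v y) = y
      rw [← leftAct_mul, hwv, leftAct_mul, hcM _ y.2, hcM _ y.2]⟩
  have hwx : fw ⟨x, hxM⟩ = 0 := Subtype.ext <| by
    change leftAct (toConv (B c)) x = 0
    rw [hB, hx]
    simp [rightAct]
  exact congrArg Subtype.val
    ((injective_iff_map_eq_zero fw).1 (LinearMap.injective_iff_surjective.2 hfw) _ hwx)

/-- The non-unital Frobenius algebra with multiplication `r s = r₁ B(s, r₂) = B(s₁, r) s₂`. -/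
def toFrobenius (hB : IsBalanced B) : NonUnitalFrobenius k C where
  mul := TensorProduct.lift (leftActHom ∘ₗ B).flip
  mul_assoc := by
    ext r s t
    change leftAct (toConv (B t)) (leftAct (toConv (B s)) r) =
      leftAct (toConv (B (leftAct (toConv (B t)) s))) r
    rw [hB.toConv_leftAct, leftAct_mul]
  -- Both Frobenius identities say that an action commutes with `Δ` on the opposite leg;
  -- balancedness lets the product be read as either action.
  comul_left := by
    ext r s
    have h : ∀ t : C ⊗[k] C, LinearMap.rTensor C (TensorProduct.lift (leftActHom ∘ₗ B).flip)
        ((TensorProduct.assoc k C C C).symm (r ⊗ₜ t)) =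
          LinearMap.rTensor C (rightAct (toConv (B.flip r))) t := by
      intro t
      induction t with
      | zero => simp
      | add x y hx hy => simp only [map_add, TensorProduct.tmul_add, hx, hy]
      | tmul a b => exact congrArg (· ⊗ₜ b) (hB r a)
    change LinearMap.rTensor C (TensorProduct.lift (leftActHom ∘ₗ B).flip)
        ((TensorProduct.assoc k C C C).symm (r ⊗ₜ Coalgebra.comul (R := k) s)) =
      Coalgebra.comul (R := k) (leftAct (toConv (B s)) r)
    rw [h, hB, comul_rightAct]
  comul_right := by
    ext r s
    have h : ∀ t : C ⊗[k] C, LinearMap.lTensor C (TensorProduct.lift (leftActHom ∘ₗ B).flip)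
        (TensorProduct.assoc k C C C (t ⊗ₜ s)) =
          LinearMap.lTensor C (leftAct (toConv (B s))) t := by
      intro t
      induction t with
      | zero => simp
      | add x y hx hy => simp only [map_add, TensorProduct.add_tmul, hx, hy]
      | tmul a b => rfl
    change LinearMap.lTensor C (TensorProduct.lift (leftActHom ∘ₗ B).flip)
        (TensorProduct.assoc k C C C (Coalgebra.comul (R := k) r ⊗ₜ s)) =
      Coalgebra.comul (R := k) (leftAct (toConv (B s)) r)
    rw [h, comul_leftAct]

theorem toFrobenius_mul (hB : IsBalanced B) (r s : C) :
    hB.toFrobenius.mul (r ⊗ₜ s) = leftAct (toConv (B s)) r := rfl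

/-- Applying `ε` to the product `s r` recovers `B(r, s)`. -/
theorem nonDegenerate_toFrobenius (hB : IsBalanced B) (hi : Function.Injective B)
    (hi' : Function.Injective B.flip) : hB.toFrobenius.NonDegenerate := by
  have key (r s : C) (h : hB.toFrobenius.mul (s ⊗ₜ r) = 0) : B r s = 0 := by
    rw [toFrobenius_mul] at h
    simpa [h] using (counit_leftAct (toConv (B r)) s).symm
  refine ⟨fun r h => ?_, fun r h => ?_⟩
  · exact (injective_iff_map_eq_zero B).1 hi r (LinearMap.ext fun s => key r s (h s))
  · exact (injective_iff_map_eq_zero B.flip).1 hi' r (LinearMap.ext fun s => key s r (h s))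

end IsBalanced

/-! ### From module monomorphisms and Frobenius algebras to balanced forms -/

theorem IsLeftCoFrobenius.exists_isBalanced (h : IsLeftCoFrobenius k C) :
    ∃ B : C →ₗ[k] C →ₗ[k] k, IsBalanced B ∧ Function.Injective B := by
  let _ := leftModule k C
  obtain ⟨f, hf⟩ := h
  have hsmul (φ : ConvDual k C) (s : C) : f (leftAct φ s) = φ * f s := f.map_smul φ s
  let B : C →ₗ[k] C →ₗ[k] k :=
    { toFun := fun s => (f s).ofConv
      map_add' := fun x y => by simp
      map_smul' := fun a s => by
        -- Scalars act through `a • ε`, so `C*`-linearity forces `k`-linearity.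
        have h1 : leftAct (a • (1 : ConvDual k C)) s = a • s := by
          conv_rhs => rw [← leftAct_one (k := k) s]
          exact LinearMap.congr_fun (leftActHom.map_smul a (1 : ConvDual k C).ofConv) s
        rw [← h1, hsmul, smul_mul_assoc, one_mul]
        simp }
  exact ⟨B, .of_left hsmul, ofConv_injective.comp hf⟩

theorem IsRightCoFrobenius.exists_isBalanced (h : IsRightCoFrobenius k C) :
    ∃ B : C →ₗ[k] C →ₗ[k] k, IsBalanced B ∧ Function.Injective B.flip := by
  let _ := rightModule k C
  obtain ⟨f, hf⟩ := h
  have hsmul (φ : ConvDual k C) (s : C) : f (rightAct φ s) = f s * φ :=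
    f.map_smul (MulOpposite.op φ) s
  let B : C →ₗ[k] C →ₗ[k] k :=
    { toFun := fun s => (f s).ofConv
      map_add' := fun x y => by simp
      map_smul' := fun a s => by
        have h1 : rightAct (a • (1 : ConvDual k C)) s = a • s := by
          conv_rhs => rw [← rightAct_one (k := k) s]
          let 𝓡 := Coalgebra.Repr.arbitrary k s
          rw [rightAct_apply_repr 𝓡, rightAct_apply_repr 𝓡]
          simp [Finset.smul_sum, mul_smul]
        rw [← h1, hsmul, mul_smul_comm, mul_one]
        simp }
  exact ⟨B.flip, .of_right hsmul, ofConv_injective.comp hf⟩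

namespace NonUnitalFrobenius

variable (R : NonUnitalFrobenius k C)

/-- The bilinear form `(s, r) ↦ ε(r s)` of a Frobenius algebra. -/
def form : C →ₗ[k] C →ₗ[k] k :=
  ((TensorProduct.mk k C C).compr₂ (Coalgebra.counit ∘ₗ R.mul)).flip

/-- This is `C ⊗ ε` applied to `(C ⊗ μ)(Δ ⊗ C) = Δ μ`. -/
theorem leftAct_form (r s : C) : leftAct (toConv (R.form s)) r = R.mul (r ⊗ₜ s) := by
  have h : ∀ t : C ⊗[k] C, TensorProduct.rid k C (LinearMap.lTensor C (R.form s) t) =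
      TensorProduct.rid k C (LinearMap.lTensor C Coalgebra.counit
        (LinearMap.lTensor C R.mul (TensorProduct.assoc k C C C (t ⊗ₜ s)))) := by
    intro t
    induction t with
    | zero => simp
    | add x y hx hy => simp only [map_add, TensorProduct.add_tmul, hx, hy]
    | tmul a b => rfl
  refine (h _).trans ?_
  have h2 := LinearMap.congr_fun R.comul_right (r ⊗ₜ s)
  simp only [LinearMap.comp_apply, LinearMap.rTensor_tmul, LinearEquiv.coe_coe] at h2
  rw [h2]
  simp

theorem rightAct_form (r s : C) : rightAct (toConv (R.form.flip r)) s = R.mul (r ⊗ₜ s) := by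
  have h : ∀ t : C ⊗[k] C, TensorProduct.lid k C (LinearMap.rTensor C (R.form.flip r) t) =
      TensorProduct.lid k C (LinearMap.rTensor C Coalgebra.counit
        (LinearMap.rTensor C R.mul ((TensorProduct.assoc k C C C).symm (r ⊗ₜ t)))) := by
    intro t
    induction t with
    | zero => simp
    | add x y hx hy => simp only [map_add, TensorProduct.tmul_add, hx, hy]
    | tmul a b => rfl
  refine (h _).trans ?_
  have h2 := LinearMap.congr_fun R.comul_left (r ⊗ₜ s)
  simp only [LinearMap.comp_apply, LinearMap.lTensor_tmul, LinearEquiv.coe_coe] at h2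
  rw [h2]
  simp

theorem isBalanced_form : IsBalanced R.form := fun r s => by
  rw [leftAct_form, rightAct_form]

variable {R}

theorem NonDegenerate.injective_form (h : R.NonDegenerate) : Function.Injective R.form := by
  rw [injective_iff_map_eq_zero]
  refine fun r hr => h.1 r fun s => ?_
  rw [← leftAct_form, hr]
  simp [leftAct]

theorem NonDegenerate.injective_form_flip (h : R.NonDegenerate) :
    Function.Injective R.form.flip := by
  rw [injective_iff_map_eq_zero]
  refine fun r hr => h.2 r fun s => ?_
  rw [← rightAct_form, hr]
  simp [rightAct]

end NonUnitalFrobenius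

/-! ### Idempotents and local units -/

open Polynomial in
/-- A form of Fitting's lemma: some polynomial without constant term in a finite rank endomorphism
is idempotent and fixes the fixed vectors. -/
theorem exists_isIdempotentElem_aeval {V : Type*} [AddCommGroup V] [Module k V]
    (T : Module.End k V) [FiniteDimensional k (LinearMap.range T)] :
    ∃ p : k[X], IsIdempotentElem (aeval T (p * X)) ∧
      ∀ r, T r = r → aeval T (p * X) r = r := by
  let f : Module.End k (LinearMap.range T) := T.restrict fun y _ => LinearMap.mem_range_self T y
  have hf (p : k[X]) (y : LinearMap.range T) : aeval T p y = aeval f p y := by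
    induction p using Polynomial.induction_on' with
    | add p q hp hq => simp [hp, hq]
    | monomial n a =>
      simp only [aeval_monomial, Module.algebraMap_end_eq_smul_id, LinearMap.smul_apply,
        Module.End.mul_apply, LinearMap.id_apply, Submodule.coe_smul]
      congr 1
      induction n with
      | zero => simp
      | succ n ih =>
        rw [pow_succ', pow_succ', Module.End.mul_apply, Module.End.mul_apply, ih]
        rfl
  -- The factor `X` moves vectors into the range of `T`, where the minimal polynomial vanishes. It
  -- also makes the multiplicity of the root `0` positive.
  set P : k[X] := minpoly k f * X with hP
  have hP0 : P ≠ 0 := mul_ne_zero (minpoly.ne_zero (Algebra.IsIntegral.isIntegral f)) X_ne_zero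
  have hPT : aeval T P = 0 := by
    ext x
    have := hf (minpoly k f) ⟨T x, LinearMap.mem_range_self T x⟩
    rw [minpoly.aeval] at this
    simpa [hP] using this
  obtain ⟨q, hq, hXq⟩ := P.exists_eq_pow_rootMultiplicity_mul_and_not_dvd hP0 0
  rw [C_0, sub_zero] at hq hXq
  generalize P.rootMultiplicity 0 = n at hq
  have hn : n ≠ 0 := by
    rintro rfl
    rw [pow_zero, one_mul] at hq
    exact hXq (hq ▸ Dvd.intro_left _ rfl)
  obtain ⟨n, rfl⟩ := Nat.exists_eq_succ_of_ne_zero hn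
  -- From `a X^(n+1) + b q = 1`, the element `a X^(n+1)` is idempotent modulo `P = X^(n+1) q`. On a
  -- vector fixed by `T`, `P(T) = 0` gives `q(T) r = 0`, so only the first summand survives.
  obtain ⟨a, b, hab⟩ : IsCoprime (X ^ (n + 1)) q :=
    (irreducible_X.coprime_iff_not_dvd.2 hXq).pow_left
  refine ⟨a * X ^ n, ?_, fun r hr => ?_⟩
  · have h : a * X ^ n * X * (a * X ^ n * X) = a * X ^ n * X - a * b * P := by
      rw [hq, Nat.succ_eq_add_one, ← sub_eq_zero]
      linear_combination (a * X ^ (n + 1)) * hab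
    rw [IsIdempotentElem, ← map_mul, h, map_sub, map_mul _ (a * b), hPT, mul_zero, sub_zero]
  · have hpow : ∀ m : ℕ, (T ^ m) r = r := fun m => by
      induction m with
      | zero => rfl
      | succ m ih => rw [pow_succ, Module.End.mul_apply, hr, ih]
    have hqr : aeval T q r = 0 := by
      have := LinearMap.congr_fun hPT r
      rw [hq, mul_comm] at this
      simpa [hpow] using this
    have := congrArg (fun p => aeval T p r) hab
    simp only [map_add, map_mul, LinearMap.add_apply, Module.End.mul_apply, hqr, map_zero,
      add_zero, map_one, Module.End.one_apply] at this
    rw [mul_assoc, ← pow_succ, map_mul]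
    exact this

/-- In an associative algebra that acts faithfully on itself by endomorphisms of finite rank, a
left unit of a set can be replaced by an idempotent one. -/
theorem exists_idempotent_forall_apply_eq {V : Type*} [AddCommGroup V] [Module k V]
    {m : V →ₗ[k] V →ₗ[k] V} (assoc : ∀ x y z, m (m x y) z = m x (m y z))
    (hm : Function.Injective m) {d : V} [FiniteDimensional k (LinearMap.range (m d))] {F : Set V}
    (hd : ∀ r ∈ F, m d r = r) : ∃ e, m e e = e ∧ ∀ r ∈ F, m e r = r := by
  obtain ⟨p, hp, hfix⟩ := exists_isIdempotentElem_aeval (m d)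
  have h : ∀ x y, m (m x y) = m x * m y := fun x y => LinearMap.ext (assoc x y)
  have hpow (n : ℕ) (s : V) : m ((m d ^ n) s) = m d ^ n * m s := by
    induction n with
    | zero => rw [pow_zero, one_mul, Module.End.one_apply]
    | succ n ih => rw [pow_succ', Module.End.mul_apply, h, ih, mul_assoc]
  have key (q : Polynomial k) (s : V) :
      m (Polynomial.aeval (m d) q s) = Polynomial.aeval (m d) q * m s := by
    induction q using Polynomial.induction_on' with
    | add q q' hq hq' => simp [hq, hq', add_mul]
    | monomial n a =>
      rw [Polynomial.aeval_monomial, ← Algebra.smul_def, LinearMap.smul_apply, map_smul, hpow,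
        smul_mul_assoc]
  -- Having no constant term, `p X` evaluated at `m d` is again multiplication by an element of `V`.
  have he : m (Polynomial.aeval (m d) p d) = Polynomial.aeval (m d) (p * Polynomial.X) := by
    rw [key, map_mul, Polynomial.aeval_X]
  refine ⟨Polynomial.aeval (m d) p d, hm ?_, fun r hr => ?_⟩
  · rw [h, he]
    exact hp
  · rw [he]
    exact hfix r (hd r hr)

/-- One-sided idempotent local units on both sides yield two-sided idempotent local units. -/
theorem exists_idempotent_forall_two_sided {V : Type*} [AddCommGroup V] [Module k V]
    {m : V →ₗ[k] V →ₗ[k] V} (assoc : ∀ x y z, m (m x y) z = m x (m y z))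
    (hl : ∀ F : Finset V, ∃ e, m e e = e ∧ ∀ r ∈ F, m e r = r)
    (hr : ∀ F : Finset V, ∃ e, m e e = e ∧ ∀ r ∈ F, m r e = r) (F : Finset V) :
    ∃ e, m e e = e ∧ ∀ r ∈ F, m e r = r ∧ m r e = r := by
  classical
  obtain ⟨d, hdd, hd⟩ := hl F
  obtain ⟨e, hee, he⟩ := hr (insert d F)
  have hde := he d (Finset.mem_insert_self d F)
  -- Formally `1 - u = (1 - e)(1 - d)`. Idempotency needs `d e = d`, hence the choice of `e` with
  -- `d` adjoined to `F`.
  refine ⟨d + e - m e d, ?_, fun r hrF => ⟨?_, ?_⟩⟩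
  · simp only [map_add, map_sub, LinearMap.add_apply, LinearMap.sub_apply, assoc, hdd, hee, hde]
    rw [← assoc d e d, hde, hdd, ← assoc e e d, hee]
    abel
  · simp [assoc, hd r hrF]
  · have hre := he r (Finset.mem_insert_of_mem hrF)
    simp [← assoc, hre]

/-! ### Local units, non-degeneracy and firmness of Frobenius algebras -/

namespace NonUnitalFrobenius

variable {R : NonUnitalFrobenius k C}

theorem mul_mul (R : NonUnitalFrobenius k C) (x y z : C) :
    R.mul (R.mul (x ⊗ₜ y) ⊗ₜ z) = R.mul (x ⊗ₜ R.mul (y ⊗ₜ z)) :=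
  LinearMap.congr_fun R.mul_assoc ((x ⊗ₜ y) ⊗ₜ z)

theorem NonDegenerate.hasLocalUnits (h : R.NonDegenerate) : R.HasLocalUnits := by
  let m : C →ₗ[k] C →ₗ[k] C := (TensorProduct.mk k C C).compr₂ R.mul
  have hm : Function.Injective m := (injective_iff_map_eq_zero m).2 fun r hr =>
    h.2 r fun s => LinearMap.congr_fun hr s
  have hm' : Function.Injective m.flip := (injective_iff_map_eq_zero m.flip).2 fun r hr =>
    h.1 r fun s => LinearMap.congr_fun hr s
  refine ⟨{e | R.mul (e ⊗ₜ e) = e}, fun e he => he,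
    exists_idempotent_forall_two_sided (m := m) R.mul_mul (fun F => ?_) (fun F => ?_)⟩
  · obtain ⟨d, hd⟩ := exists_rightAct_flip_eq_self h.injective_form F
    -- Every `d s` lies in the span of the left legs of `Δ(d)`.
    have : FiniteDimensional k (LinearMap.range (m d)) := by
      obtain ⟨W, _, hW⟩ := exists_finiteDimensional_forall_leftAct_mem (k := k) d
      refine Submodule.finiteDimensional_of_le (S₂ := W) ?_
      rintro _ ⟨s, rfl⟩
      exact R.leftAct_form d s ▸ hW (toConv (R.form s))
    exact exists_idempotent_forall_apply_eq (F := F) R.mul_mul hm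
      fun r hr => (R.rightAct_form d r).symm.trans (hd r hr)
  · obtain ⟨d, hd⟩ := exists_leftAct_eq_self h.injective_form_flip F
    have : FiniteDimensional k (LinearMap.range (m.flip d)) := by
      obtain ⟨W, _, hW⟩ := exists_finiteDimensional_forall_rightAct_mem (k := k) d
      refine Submodule.finiteDimensional_of_le (S₂ := W) ?_
      rintro _ ⟨s, rfl⟩
      exact R.rightAct_form s d ▸ hW (toConv (R.form.flip s))
    exact exists_idempotent_forall_apply_eq (F := F) (m := m.flip)
      (fun x y z => (R.mul_mul z y x).symm) hm'
      fun r hr => (R.leftAct_form r d).symm.trans (hd r hr)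

theorem HasLocalUnits.nonDegenerate (h : R.HasLocalUnits) : R.NonDegenerate := by
  obtain ⟨E, -, hE⟩ := h
  refine ⟨fun r hr => ?_, fun r hr => ?_⟩ <;>
    obtain ⟨e, -, he⟩ := hE {r} <;>
    obtain ⟨h1, h2⟩ := he r (Finset.mem_singleton_self r)
  · rw [← h1, hr]
  · rw [← h2, hr]

theorem HasLocalUnits.firm (h : R.HasLocalUnits) : R.Firm := by
  classical
  obtain ⟨E, -, hE⟩ := h
  constructor
  · rw [injective_iff_map_eq_zero]
    intro x hx
    obtain ⟨t, rfl⟩ := R.balancing.mkQ_surjective x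
    have htk : R.mul t = 0 := hx
    -- If `e a = a`, then `a ⊗ b = e a ⊗ b` and `e ⊗ a b` agree in the quotient.
    have key (t : C ⊗[k] C) : ∃ F : Finset C, ∀ e, (∀ r ∈ F, R.mul (e ⊗ₜ r) = r) →
        R.balancing.mkQ t = R.balancing.mkQ (e ⊗ₜ R.mul t) := by
      induction t with
      | zero => exact ⟨∅, by simp⟩
      | add x y hx hy =>
        obtain ⟨F, hF⟩ := hx
        obtain ⟨G, hG⟩ := hy
        refine ⟨F ∪ G, fun e he => ?_⟩
        rw [map_add, map_add, TensorProduct.tmul_add, map_add,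
          hF e fun r hr => he r (Finset.mem_union_left G hr),
          hG e fun r hr => he r (Finset.mem_union_right F hr)]
      | tmul a b =>
        refine ⟨{a}, fun e he => ?_⟩
        have ha := he a (Finset.mem_singleton_self a)
        rw [← sub_eq_zero, ← map_sub, Submodule.mkQ_apply, Submodule.Quotient.mk_eq_zero]
        refine ⟨(e ⊗ₜ a) ⊗ₜ b, ?_⟩
        simp [ha]
    obtain ⟨F, hF⟩ := key t
    obtain ⟨e, -, he⟩ := hE F
    rw [hF e fun r hr => (he r hr).1, htk, TensorProduct.tmul_zero, map_zero]
  · intro r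
    obtain ⟨e, -, he⟩ := hE {r}
    exact ⟨R.balancing.mkQ (e ⊗ₜ r), (he r (Finset.mem_singleton_self r)).1⟩

end NonUnitalFrobenius

end CoFrob
end

theorem proposition6p5 {k : Type*} {C : Type*} [Field k] [AddCommGroup C] [Module k C]
    [Coalgebra k C] :
    List.TFAE [
      CoFrob.IsLeftCoFrobenius k C ∧ CoFrob.IsRightCoFrobenius k C,
      ∃ R : CoFrob.NonUnitalFrobenius k C, R.NonDegenerate,
      ∃ R : CoFrob.NonUnitalFrobenius k C, R.Firm ∧ R.HasLocalUnits] := by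
  tfae_have 1 → 2 := by
    rintro ⟨hl, hr⟩
    obtain ⟨B, hB, hi⟩ := hl.exists_isBalanced
    obtain ⟨B', hB', hi'⟩ := hr.exists_isBalanced
    exact ⟨hB.toFrobenius, hB.nonDegenerate_toFrobenius hi (hB.flip_injective hB' hi hi')⟩
  tfae_have 2 → 1 := fun ⟨R, hR⟩ => ⟨R.isBalanced_form.isLeftCoFrobenius hR.injective_form,
    R.isBalanced_form.isRightCoFrobenius hR.injective_form_flip⟩
  tfae_have 2 → 3 := fun ⟨R, hR⟩ => ⟨R, hR.hasLocalUnits.firm, hR.hasLocalUnits⟩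
  tfae_have 3 → 2 := fun ⟨R, _, hR⟩ => ⟨R, hR.nonDegenerate⟩
  tfae_finish
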